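/- Let $X$ and $Y$ be compact Polish spaces with their Borel $\sigma$-fields, $d\ge 1$, and let $\boldsymbol\mu=(\mu_1,\dots,\mu_d)$ and $\boldsymbol\nu=(\nu_1,\dots,\nu_d)$ be $d$-tuples of finite Borel measures on $X$ and $Y$ with $\mu_j(X)\ge\nu_j(Y)>0$ for every $j$. Put $\bar\mu=\sum_j\mu_j/\sum_j\mu_j(X)$ and $\boldsymbol\mu'=(\mathrm d\mu_1/\mathrm d\bar\mu,\dots,\mathrm d\mu_d/\mathrm d\bar\mu)$. Let $\eta$ be a Borel probability measure on $X$ that is equivalent to $\bar\mu$ (that is, $\eta\ll\bar\mu\ll\eta$), and let $c:X\times Y\to[0,\infty]$ be continuous. Assume that $\boldsymbol\mu$ is jointly atomless: there is a measurable $\xi:X\to\mathbb R$ which under $\bar\mu$ has an atomless law and is independent of $\boldsymbol\mu'$. Let $\mathcal T(\boldsymbol\mu,\boldsymbol\nu)$ be the set of measurable maps $T:X\to Y$ such that $\mu_j\circ T^{-1}\ge\nu_j$ for all $j$. Let $\mathcal K(\boldsymbol\mu,\boldsymbol\nu)$ be the set of stochastic kernels $\kappa$ from $X$ to $Y$ such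 that $\int_X\kappa(x;B)\,\mu_j(\mathrm dx)\ge\nu_j(B)$ for all $j$ and all Borel $B\subseteq Y$. Let $\Pi_\eta(\boldsymbol\mu,\boldsymbol\nu)=\{\eta\otimes\kappa:\kappa\in\mathcal K(\boldsymbol\mu,\boldsymbol\nu)\}$. Then $$\inf_{\kappa\in\mathcal K(\boldsymbol\mu,\boldsymbol\nu)}\int_{X\times Y}c\,\mathrm d(\eta\otimes\kappa)=\inf_{T\in\mathcal T(\boldsymbol\mu,\boldsymbol\nu)}\int_X c(x,T(x))\,\eta(\mathrm dx)$$ and $$\inf_{\pi\in\Pi_\eta(\boldsymbol\mu,\boldsymbol\nu)}\int_{X\times Y}c\,\mathrm d\pi=\inf_{T\in\mathcal T(\boldsymbol\mu,\boldsymbol\nu)}\int_X c(x,T(x))\,\eta(\mathrm dx),$$ where the infimum over an empty set is $\infty$. -/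

import Mathlib

open MeasureTheory ProbabilityTheory
open scoped ENNReal

namespace SimultaneousOT

/-- The normalized average `(∑ j, μ j) / (∑ j, μ j X)` of a tuple of measures. -/
noncomputable def avgMeasure {X : Type*} [MeasurableSpace X] {d : ℕ}
    (μ : Fin d → Measure X) : Measure X :=
  (∑ j, μ j Set.univ)⁻¹ • ∑ j, μ j

/-- The vector of Radon-Nikodym densities of the components of the tuple with respect to the
normalized average measure. -/
noncomputable def density {X : Type*} [MeasurableSpace X] {d : ℕ}
    (μ : Fin d → Measure X) (x : X) : Fin d → ℝ :=
  fun j => ((μ j).rnDeriv (avgMeasure μ) x).toReal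

/-- A tuple of measures is jointly atomless if some real random variable has, under the normalized
average measure, an atomless law and is independent of the density vector. -/
def JointlyAtomless {X : Type*} [MeasurableSpace X] {d : ℕ} (μ : Fin d → Measure X) : Prop :=
  ∃ ξ : X → ℝ, Measurable ξ ∧ (∀ t : ℝ, (avgMeasure μ).map ξ {t} = 0) ∧
    IndepFun ξ (density μ) (avgMeasure μ)

/-- Simultaneous transport maps: measurable `T` whose push-forward of each `μ j` covers `ν j`. -/
def transportMaps {X Y : Type*} [MeasurableSpace X] [MeasurableSpace Y] {d : ℕ}
    (μ : Fin d → Measure X) (ν : Fin d → Measure Y) : Set (X → Y) :=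
  {T | Measurable T ∧ ∀ j, ν j ≤ (μ j).map T}

/-- Simultaneous transport kernels: stochastic kernels `κ` such that
`B ↦ ∫ κ(x; B) μ_j(dx)` covers `ν j` for each `j`. -/
def transportKernels {X Y : Type*} [MeasurableSpace X] [MeasurableSpace Y] {d : ℕ}
    (μ : Fin d → Measure X) (ν : Fin d → Measure Y) : Set (Kernel X Y) :=
  {κ | IsMarkovKernel κ ∧ ∀ j, ν j ≤ (μ j).bind κ}

/-- Simultaneous transport plans with reference measure `η`: the measures `η ⊗ κ` with `κ` a
simultaneous transport kernel. -/
def transportPlans {X Y : Type*} [MeasurableSpace X] [MeasurableSpace Y] {d : ℕ}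
    (η : Measure X) (μ : Fin d → Measure X) (ν : Fin d → Measure Y) : Set (Measure (X × Y)) :=
  {π | ∃ κ ∈ transportKernels μ ν, π = η ⊗ₘ κ}

/-- The cost of a plan: the integral of `c`. -/
noncomputable def planCost {X Y : Type*} [MeasurableSpace X] [MeasurableSpace Y]
    (c : X × Y → ℝ≥0∞) (π : Measure (X × Y)) : ℝ≥0∞ :=
  ∫⁻ p, c p ∂π

/-- The cost of a kernel with respect to the reference measure `η`. -/
noncomputable def kernelCost {X Y : Type*} [MeasurableSpace X] [MeasurableSpace Y]
    (c : X × Y → ℝ≥0∞) (η : Measure X) (κ : Kernel X Y) : ℝ≥0∞ :=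
  ∫⁻ p, c p ∂(η ⊗ₘ κ)

/-- The cost of a map with respect to the reference measure `η`. -/
noncomputable def mapCost {X Y : Type*} [MeasurableSpace X]
    (c : X × Y → ℝ≥0∞) (η : Measure X) (T : X → Y) : ℝ≥0∞ :=
  ∫⁻ x, c (x, T x) ∂η

end SimultaneousOT

namespace SimultaneousOT

open Set unitInterval

/-! A map is a deterministic kernel of the same cost, so only the reverse inequality has content.
Write m for the average measure and g for the density vector. Each μ_j has an m-density that is a
function of g, so its image under a map or a kernel depends only on the joint law of g and the
target point. It is therefore enough to replace a kernel κ of finite cost by a map T for which (g,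
T) has the law prescribed by m ⊗ κ, at almost the same cost.

For the cost, m ⊗ κ is cut into countably many cells Q k inside rectangles A k × B k on which c and
the weight dη/dm hardly vary. If T sends a set D k ⊆ A k of the same mass as Q k into B k, the costs
compare cell by cell. `AtomlessGiven.exists_disjoint_measure_eq` turns the fractions κ(x; Q k) into
such disjoint sets without changing their masses given g; `AtomlessGiven.exists_map_prodMk_eq` then
uses ξ as a randomizer on each D k.

On D k the variable ξ need not be independent of g any more. Hence independence is weakened at the
outset to `AtomlessGiven`, which survives absolutely continuous changes of measure and the
adjunction of a discrete variable to g. -/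

/-! ### Probability integral transform -/

/-- The distribution function of a probability measure on `ℝ`, with values in the unit interval. -/
noncomputable def unitCdf (ρ : Measure ℝ) [IsProbabilityMeasure ρ] (t : ℝ) : I :=
  ⟨ρ.real (Iic t), measureReal_nonneg, measureReal_le_one⟩

lemma monotone_unitCdf (ρ : Measure ℝ) [IsProbabilityMeasure ρ] : Monotone (unitCdf ρ) :=
  fun _ _ h => Subtype.mk_le_mk.2 (measureReal_mono (Iic_subset_Iic.2 h))

lemma continuous_cdf_of_noAtoms (ρ : Measure ℝ) [IsProbabilityMeasure ρ]
    (h : ∀ t, ρ {t} = 0) : Continuous (cdf ρ) := by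
  refine continuous_iff_continuousAt.2 fun t => ?_
  rw [(cdf ρ).mono.continuousAt_iff_leftLim_eq_rightLim, StieltjesFunction.rightLim_eq]
  have h1 := (cdf ρ).measure_singleton t
  rw [measure_cdf, h t] at h1
  have h2 := ENNReal.ofReal_eq_zero.1 h1.symm
  exact le_antisymm ((cdf ρ).mono.leftLim_le le_rfl) (by linarith)

/-- The probability integral transform. -/
lemma map_unitCdf (ρ : Measure ℝ) [IsProbabilityMeasure ρ] (h : ∀ t, ρ {t} = 0) :
    ρ.map (unitCdf ρ) = volume := by
  have hm : Measurable (unitCdf ρ) := (monotone_unitCdf ρ).measurable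
  have : IsProbabilityMeasure (ρ.map (unitCdf ρ)) := Measure.isProbabilityMeasure_map hm.aemeasurable
  have hcont := continuous_cdf_of_noAtoms ρ h
  -- By continuity every level strictly between 0 and 1 is attained, so sublevel sets of the
  -- distribution function can be squeezed between half-lines of known mass.
  have hex : ∀ r : ℝ, 0 < r → r < 1 → ∃ t, ρ.real (Iic t) = r := by
    intro r h0 h1
    obtain ⟨a, ha⟩ := ((tendsto_cdf_atBot ρ).eventually (gt_mem_nhds h0)).exists
    obtain ⟨b, hb⟩ := ((tendsto_cdf_atTop ρ).eventually (lt_mem_nhds h1)).exists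
    obtain ⟨t, ht⟩ := mem_range_of_exists_le_of_exists_ge hcont ⟨a, ha.le⟩ ⟨b, hb.le⟩
    exact ⟨t, by rw [← ProbabilityTheory.cdf_eq_real, ht]⟩
  refine Measure.ext_of_Iic _ _ fun x => ?_
  rw [Measure.map_apply hm measurableSet_Iic, unitInterval.volume_Iic]
  have key : ρ.real (unitCdf ρ ⁻¹' Iic x) = x := by
    apply le_antisymm
    · refine le_of_forall_gt_imp_ge_of_dense fun r hr => ?_
      rcases lt_or_ge r 1 with h1 | h1
      · obtain ⟨t, ht⟩ := hex r (x.2.1.trans_lt hr) h1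
        rw [← ht]
        refine measureReal_mono fun s hs => ?_
        by_contra hst
        have h3 : ρ.real (Iic t) ≤ ρ.real (Iic s) :=
          measureReal_mono (Iic_subset_Iic.2 (not_le.1 hst).le)
        have h4 : ρ.real (Iic s) ≤ x := hs
        linarith
      · exact measureReal_le_one.trans h1
    · refine le_of_forall_lt_imp_le_of_dense fun r hr => ?_
      rcases le_or_gt r 0 with h0 | h0
      · exact h0.trans measureReal_nonneg
      · obtain ⟨t, ht⟩ := hex r h0 (hr.trans_le x.2.2)
        rw [← ht]
        refine measureReal_mono fun s hs => ?_
        have h3 : ρ.real (Iic s) ≤ ρ.real (Iic t) := measureReal_mono (Iic_subset_Iic.2 hs)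
        exact (h3.trans (ht.le.trans hr.le) : ρ.real (Iic s) ≤ (x : ℝ))
  rw [← key, ofReal_measureReal]

/-! ### Conditional atomlessness -/

variable {X Y Z : Type*} [MeasurableSpace X] [MeasurableSpace Y] [MeasurableSpace Z]

/-- `ξ` has no atoms conditionally on `g`: the graph of every measurable function has measure
zero under the joint law of `g` and `ξ`. -/
def AtomlessGiven (ξ : X → ℝ) (g : X → Z) (m : Measure X) : Prop :=
  ∀ s : Z → ℝ, Measurable s → m {x | ξ x = s (g x)} = 0

lemma AtomlessGiven.mono_ac {ξ : X → ℝ} {g : X → Z} {m m' : Measure X}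
    (h : AtomlessGiven ξ g m) (hm : m' ≪ m) : AtomlessGiven ξ g m' :=
  fun s hs => hm (h s hs)

/-- A graph over Z × ℕ is a countable union of graphs over Z. This permits conditioning on the
current stage of a discrete construction. -/
lemma AtomlessGiven.prodMk_nat {ξ : X → ℝ} {g : X → Z} {m : Measure X}
    (h : AtomlessGiven ξ g m) (o : X → ℕ) : AtomlessGiven ξ (fun x => (g x, o x)) m := by
  intro s hs
  refine measure_mono_null (t := ⋃ k, {x | ξ x = s (g x, k)}) ?_ ?_
  · intro x hx
    exact mem_iUnion.2 ⟨o x, hx⟩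
  · exact measure_iUnion_null fun k => h (fun z => s (z, k)) (hs.comp (by fun_prop))

/-- Fubini: under the product law every section of the graph is a single point, hence null. -/
lemma atomlessGiven_of_indepFun {ξ : X → ℝ} {g : X → Z} {m : Measure X} [IsFiniteMeasure m]
    (hξ : Measurable ξ) (hg : Measurable g) (hat : ∀ t, m.map ξ {t} = 0)
    (hind : IndepFun ξ g m) : AtomlessGiven ξ g m := by
  intro s hs
  have hS : MeasurableSet {p : ℝ × Z | p.1 = s p.2} :=
    measurableSet_eq_fun measurable_fst (hs.comp measurable_snd)
  have h1 := (indepFun_iff_map_prod_eq_prod_map_map hξ.aemeasurable hg.aemeasurable).1 hind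
  have h2 : m.map (fun x => (ξ x, g x)) {p : ℝ × Z | p.1 = s p.2} = 0 := by
    rw [h1, Measure.prod_apply_symm hS]
    refine lintegral_eq_zero_of_ae_eq_zero (Filter.Eventually.of_forall fun z => ?_)
    exact hat (s z)
  rwa [Measure.map_apply (hξ.prodMk hg) hS] at h2

/-- The generalized inverse of the distribution functions of a kernel. -/
noncomputable def quantile (K : Kernel Z ℝ) (r : ℝ) (z : Z) : ℝ :=
  sInf {t | r ≤ (K z).real (Iic t)}

lemma measurable_quantile (K : Kernel Z ℝ) [IsMarkovKernel K] {r : ℝ} (h0 : 0 < r) (h1 : r < 1) :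
    Measurable (quantile K r) := by
  have hbdd : ∀ z, BddBelow {t | r ≤ (K z).real (Iic t)} := by
    intro z
    obtain ⟨a, ha⟩ := ((tendsto_cdf_atBot (K z)).eventually (gt_mem_nhds h0)).exists
    refine ⟨a, fun t ht => le_of_not_gt fun hta => ?_⟩
    have : (K z).real (Iic t) ≤ (K z).real (Iic a) := measureReal_mono (Iic_subset_Iic.2 hta.le)
    have ht' : r ≤ (K z).real (Iic t) := ht
    rw [ProbabilityTheory.cdf_eq_real] at ha
    linarith
  have hne : ∀ z, {t | r ≤ (K z).real (Iic t)}.Nonempty := by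
    intro z
    obtain ⟨b, hb⟩ := ((tendsto_cdf_atTop (K z)).eventually (lt_mem_nhds h1)).exists
    rw [ProbabilityTheory.cdf_eq_real] at hb
    exact ⟨b, hb.le⟩
  refine measurable_of_Iio fun a => ?_
  have : quantile K r ⁻¹' Iio a =
      ⋃ q : {q : ℚ // (q : ℝ) < a}, {z | r ≤ (K z).real (Iic (q : ℝ))} := by
    ext z
    simp only [mem_preimage, mem_Iio, quantile, csInf_lt_iff (hbdd z) (hne z), mem_iUnion]
    constructor
    · rintro ⟨t, ht, hta⟩
      obtain ⟨q, hq1, hq2⟩ := exists_rat_btwn hta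
      exact ⟨⟨q, hq2⟩, le_trans ht (measureReal_mono (Iic_subset_Iic.2 hq1.le))⟩
    · rintro ⟨q, hq⟩
      exact ⟨q, hq, q.2⟩
  rw [this]
  exact MeasurableSet.iUnion fun q =>
    measurableSet_le measurable_const (K.measurable_coe measurableSet_Iic).ennreal_toReal

/-- The distribution function jumps at an atom, and any rational level inside the jump has the atom
as its quantile. So countably many measurable graphs catch all atoms of all the measures K z. -/
lemma exists_quantile_eq_of_atom (K : Kernel Z ℝ) [IsMarkovKernel K] (z : Z) {t : ℝ}
    (ht : K z {t} ≠ 0) : ∃ r : ℚ, 0 < (r : ℝ) ∧ (r : ℝ) < 1 ∧ quantile K r z = t := by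
  have h1 : (K z).real (Iio t) + (K z).real {t} = (K z).real (Iic t) := by
    rw [← measureReal_union (by simp) (measurableSet_singleton t), Iio_union_right]
  have h2 : 0 < (K z).real {t} := ENNReal.toReal_pos ht (measure_ne_top _ _)
  obtain ⟨r, hr1, hr2⟩ := exists_rat_btwn (show (K z).real (Iio t) < (K z).real (Iic t) by linarith)
  have h3 : (K z).real (Iic t) ≤ 1 := measureReal_le_one
  refine ⟨r, measureReal_nonneg.trans_lt hr1, by linarith, IsLeast.csInf_eq ⟨hr2.le, fun s hs => ?_⟩⟩
  by_contra hst
  have h4 : (K z).real (Iic s) ≤ (K z).real (Iio t) :=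
    measureReal_mono (Iic_subset_Iio.2 (not_le.1 hst))
  have h5 : (r : ℝ) ≤ (K z).real (Iic s) := hs
  linarith

/-- Each rational quantile has a null graph; discarding countably many null sets of z leaves no room
for atoms. -/
lemma AtomlessGiven.ae_noAtoms_of_compProd_eq {ξ : X → ℝ} {g : X → Z} {m : Measure X}
    [IsFiniteMeasure m] (hξ : Measurable ξ) (hg : Measurable g) (h : AtomlessGiven ξ g m)
    {K : Kernel Z ℝ} [IsMarkovKernel K] (hK : (m.map g) ⊗ₘ K = m.map fun x => (g x, ξ x)) :
    ∀ᵐ z ∂(m.map g), ∀ t, K z {t} = 0 := by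
  have key : ∀ r : ℚ, ∀ᵐ z ∂(m.map g), 0 < (r : ℝ) → (r : ℝ) < 1 →
      K z {quantile K r z} = 0 := by
    intro r
    by_cases hr : 0 < (r : ℝ) ∧ (r : ℝ) < 1
    swap
    · exact Filter.Eventually.of_forall fun z h0 h1 => absurd ⟨h0, h1⟩ hr
    have hq := measurable_quantile K hr.1 hr.2
    have hS : MeasurableSet {p : Z × ℝ | p.2 = quantile K r p.1} :=
      measurableSet_eq_fun measurable_snd (hq.comp measurable_fst)
    have h1 : (m.map fun x => (g x, ξ x)) {p : Z × ℝ | p.2 = quantile K r p.1} = 0 := by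
      rw [Measure.map_apply (hg.prodMk hξ) hS]
      exact h _ hq
    rw [← hK, Measure.compProd_apply hS,
      lintegral_eq_zero_iff (Kernel.measurable_kernel_prodMk_left hS)] at h1
    filter_upwards [h1] with z hz _ _
    exact hz
  filter_upwards [ae_all_iff.2 key] with z hz t
  by_contra ht
  obtain ⟨r, h0, h1, rfl⟩ := exists_quantile_eq_of_atom _ z ht
  exact ht (hz r h0 h1)

/-! ### Randomization -/

/-- Randomization: if `ξ` has no atoms conditionally on `g`, every joint law with first marginal
the law of `g` is realized by a pair `(g, T)`. -/
theorem AtomlessGiven.exists_map_prodMk_eq [StandardBorelSpace Y] [Nonempty Y]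
    {ξ : X → ℝ} {g : X → Z} {m : Measure X}
    [IsFiniteMeasure m] (hξ : Measurable ξ) (hg : Measurable g) (h : AtomlessGiven ξ g m)
    (ρ : Measure (Z × Y)) [IsFiniteMeasure ρ] (hρ : ρ.fst = m.map g) :
    ∃ T : X → Y, Measurable T ∧ m.map (fun x => (g x, T x)) = ρ := by
  obtain ⟨K, _, hK⟩ : ∃ K : Kernel Z ℝ, IsMarkovKernel K ∧
      (m.map g) ⊗ₘ K = m.map fun x => (g x, ξ x) := by
    refine ⟨(m.map fun x => (g x, ξ x)).condKernel, inferInstance, ?_⟩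
    rw [← Measure.fst_map_prodMk hξ]
    exact Measure.disintegrate _ _
  -- The conditional law of ρ at z is the law of f z U with U uniform. The conditional distribution
  -- function of ξ, evaluated at ξ, serves as U.
  obtain ⟨f, hf, hfm⟩ := ρ.condKernel.exists_measurable_map_eq_unitInterval
  have hV : Measurable fun p : Z × ℝ => unitCdf (K p.1) p.2 := by
    refine Measurable.subtype_mk (Measurable.ennreal_toReal ?_)
    have hS : MeasurableSet {p : (Z × ℝ) × ℝ | p.2 ≤ p.1.2} :=
      measurableSet_le (by fun_prop) (by fun_prop)
    exact Kernel.measurable_kernel_prodMk_left (κ := K.comap Prod.fst measurable_fst) hS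
  have hfV : Measurable fun p : Z × ℝ => (p.1, f p.1 (unitCdf (K p.1) p.2)) :=
    measurable_fst.prodMk (hf.comp (measurable_fst.prodMk hV))
  refine ⟨fun x => f (g x) (unitCdf (K (g x)) (ξ x)),
    (measurable_snd.comp hfV).comp (hg.prodMk hξ), ?_⟩
  have hmap : m.map (fun x => (g x, f (g x) (unitCdf (K (g x)) (ξ x)))) =
      (m.map fun x => (g x, ξ x)).map fun p => (p.1, f p.1 (unitCdf (K p.1) p.2)) := by
    rw [Measure.map_map hfV (hg.prodMk hξ)]
    rfl
  rw [hmap, ← hK]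
  ext s hs
  conv_rhs => rw [← ρ.disintegrate ρ.condKernel, Measure.compProd_apply hs, hρ]
  rw [Measure.map_apply hfV hs, Measure.compProd_apply (hfV hs)]
  refine lintegral_congr_ae ?_
  filter_upwards [h.ae_noAtoms_of_compProd_eq hξ hg hK] with z hz
  have hsz : MeasurableSet (Prod.mk z ⁻¹' s) := measurable_prodMk_left hs
  rw [← hfm z, Measure.map_apply hf.of_uncurry_left hsz, ← map_unitCdf (K z) hz,
    Measure.map_apply (monotone_unitCdf _).measurable (hf.of_uncurry_left hsz)]
  rfl

/-! ### Purification of fractional partitions -/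

open Filter Topology

/-- Randomize a Boolean label under the measure S·m restricted to {p ≠ 0}, giving `true` the share p
and `false` the share S - p conditionally on g. Restricting the measure first is what keeps F inside
the support of p, which need not be determined by g. -/
lemma AtomlessGiven.exists_subset_setLIntegral_eq {ξ : X → ℝ} {g : X → Z} {m : Measure X}
    (hξ : Measurable ξ) (hg : Measurable g) (h : AtomlessGiven ξ g m)
    {p S : X → ℝ≥0∞} (hp : Measurable p) (hpS : p ≤ S)
    (hfin : ∫⁻ x, S x ∂m ≠ ∞) :
    ∃ F : Set X, MeasurableSet F ∧ (∀ x ∈ F, p x ≠ 0) ∧ ∀ A : Set Z, MeasurableSet A →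
      ∫⁻ x in g ⁻¹' A ∩ F, S x ∂m = ∫⁻ x in g ⁻¹' A, p x ∂m := by
  set E : Set X := {x | p x ≠ 0} with hEdef
  have hE : MeasurableSet E := hp (measurableSet_singleton 0).compl
  have hpfin : ∫⁻ x, p x ∂m ≠ ∞ := ne_top_of_le_ne_top hfin (lintegral_mono hpS)
  have hdfin : ∫⁻ x in E, (S x - p x) ∂m ≠ ∞ :=
    ne_top_of_le_ne_top hfin
      ((setLIntegral_le_lintegral _ _).trans (lintegral_mono fun x => tsub_le_self))
  have : IsFiniteMeasure ((m.restrict E).withDensity S) :=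
    isFiniteMeasure_withDensity (ne_top_of_le_ne_top hfin (setLIntegral_le_lintegral _ _))
  have : IsFiniteMeasure (m.withDensity p) := isFiniteMeasure_withDensity hpfin
  have : IsFiniteMeasure ((m.restrict E).withDensity (S - p)) :=
    isFiniteMeasure_withDensity hdfin
  have hgt : Measurable fun x => (g x, true) := by fun_prop
  have hgf : Measurable fun x => (g x, false) := by fun_prop
  have hat : AtomlessGiven ξ g ((m.restrict E).withDensity S) :=
    h.mono_ac ((withDensity_absolutelyContinuous _ _).trans
      Measure.restrict_le_self.absolutelyContinuous)
  obtain ⟨T, hT, hmap⟩ := hat.exists_map_prodMk_eq hξ hg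
    ((m.withDensity p).map (fun x => (g x, true)) +
      ((m.restrict E).withDensity (S - p)).map (fun x => (g x, false))) (by
      ext A hA
      rw [Measure.fst_apply hA, Measure.add_apply, Measure.map_apply hgt (measurable_fst hA),
        Measure.map_apply hgf (measurable_fst hA), Measure.map_apply hg hA]
      change m.withDensity p (g ⁻¹' A) + (m.restrict E).withDensity (S - p) (g ⁻¹' A) = _
      rw [withDensity_apply _ (hg hA), withDensity_apply _ (hg hA), withDensity_apply _ (hg hA)]
      have h1 : ∫⁻ x in g ⁻¹' A, p x ∂m = ∫⁻ x in g ⁻¹' A, p x ∂(m.restrict E) := by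
        rw [Measure.restrict_restrict (hg hA), ← lintegral_indicator (hg hA),
          ← lintegral_indicator ((hg hA).inter hE)]
        refine lintegral_congr fun x => ?_
        by_cases hx : p x = 0
        · simp [indicator, hx]
        · have hxE : x ∈ E := hx
          by_cases hxA : x ∈ g ⁻¹' A
          · rw [indicator_of_mem hxA, indicator_of_mem (mem_inter hxA hxE)]
          · rw [indicator_of_notMem hxA, indicator_of_notMem fun hx' => hxA hx'.1]
      rw [h1, ← lintegral_add_left hp]
      exact lintegral_congr fun x => add_tsub_cancel_of_le (hpS x))
  have hTt : MeasurableSet (T ⁻¹' {true}) := hT (measurableSet_singleton _)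
  refine ⟨T ⁻¹' {true} ∩ E, hTt.inter hE, fun x hx => hx.2, fun A hA => ?_⟩
  have h2 := congrArg (fun ρ => ρ (A ×ˢ {true})) hmap
  have hAt : MeasurableSet (A ×ˢ ({true} : Set Bool)) := hA.prod (measurableSet_singleton _)
  simp only [Measure.add_apply] at h2
  rw [Measure.map_apply (hg.prodMk hT) hAt, Measure.map_apply hgt hAt,
    Measure.map_apply hgf hAt] at h2
  have e1 : (fun x => (g x, T x)) ⁻¹' (A ×ˢ {true}) = g ⁻¹' A ∩ T ⁻¹' {true} := by
    ext x; simp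
  have e2 : (fun x => (g x, true)) ⁻¹' (A ×ˢ {true}) = g ⁻¹' A := by
    ext x; simp
  have e3 : (fun x => (g x, false)) ⁻¹' (A ×ˢ {true}) = ∅ := by
    ext x; simp
  rw [e1, e2, e3, measure_empty, add_zero, withDensity_apply _ ((hg hA).inter hTt),
    withDensity_apply _ (hg hA), Measure.restrict_restrict ((hg hA).inter hTt), inter_assoc] at h2
  exact h2

lemma measurableSet_eventually_eq {O : ℕ → X → ℕ} (hO : ∀ n, Measurable (O n)) (k : ℕ) :
    MeasurableSet {x | ∀ᶠ n in atTop, O n x = k} := by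
  have : {x | ∀ᶠ n in atTop, O n x = k} = ⋃ N, ⋂ n ∈ Ici N, O n ⁻¹' {k} := by
    ext x
    simp [eventually_atTop]
  rw [this]
  exact MeasurableSet.iUnion fun N => MeasurableSet.biInter (to_countable _) fun n _ =>
    hO n (measurableSet_singleton k)

/-- Purification of a countable fractional partition: given densities `p k` summing to one, there
are disjoint sets `D k` inside the supports of the `p k` with the same conditional masses
given `g`. -/
theorem AtomlessGiven.exists_disjoint_measure_eq {ξ : X → ℝ} {g : X → Z} {m : Measure X}
    [IsFiniteMeasure m] (hξ : Measurable ξ) (hg : Measurable g) (h : AtomlessGiven ξ g m)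
    {p : ℕ → X → ℝ≥0∞} (hp : ∀ k, Measurable (p k)) (hsum : ∀ᵐ x ∂m, ∑' k, p k x = 1) :
    ∃ D : ℕ → Set X, (∀ k, MeasurableSet (D k)) ∧ Pairwise (Function.onFun Disjoint D) ∧
      (∀ k, ∀ x ∈ D k, p k x ≠ 0) ∧
      ∀ k, ∀ A : Set Z, MeasurableSet A → m (g ⁻¹' A ∩ D k) = ∫⁻ x in g ⁻¹' A, p k x ∂m := by
  classical
  let S : ℕ → X → ℝ≥0∞ := fun n x => ∑ i ∈ Finset.range n, p i x
  have hS : ∀ n, Measurable (S n) := fun n => Finset.measurable_fun_sum _ fun i _ => hp i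
  have hS1 : ∀ᵐ x ∂m, ∀ n, S n x ≤ 1 := by
    filter_upwards [hsum] with x hx n
    exact hx ▸ ENNReal.sum_le_tsum _
  have hSfin : ∀ n, ∫⁻ x, S n x ∂m ≠ ∞ := by
    intro n
    refine ne_top_of_le_ne_top (measure_ne_top m univ) ?_
    rw [← lintegral_one]
    exact lintegral_mono_ae (hS1.mono fun x hx => hx n)
  have hSsucc : ∀ n x, S (n + 1) x = S n x + p n x := fun n x => Finset.sum_range_succ _ _
  -- Index n claims F from the earlier owners. Conditioning on the owner as well as on g makes the
  -- claim proportionate within every owner's set.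
  have hstep : ∀ n (O : {O : X → ℕ // Measurable O}), ∃ F : Set X, MeasurableSet F ∧
      (∀ x ∈ F, p n x ≠ 0) ∧ ∀ A : Set (Z × ℕ), MeasurableSet A →
      ∫⁻ x in (fun x => (g x, O.1 x)) ⁻¹' A ∩ F, S (n + 1) x ∂m =
        ∫⁻ x in (fun x => (g x, O.1 x)) ⁻¹' A, p n x ∂m := fun n O =>
    (h.prodMk_nat O.1).exists_subset_setLIntegral_eq hξ (hg.prodMk O.2) (hp n)
      (fun x => (hSsucc n x).symm ▸ le_add_self) (hSfin _)
  choose F hF hFp hFA using hstep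
  -- `O n x - 1` is the index owning `x` after `n` steps; the value `0` means that there is none.
  let O : ℕ → {O : X → ℕ // Measurable O} := fun n => Nat.rec ⟨fun _ => 0, measurable_const⟩
    (fun n o => ⟨fun x => if x ∈ F n o then n + 1 else o.1 x,
      Measurable.ite (hF n o) measurable_const o.2⟩) n
  have hO : ∀ n x, (O (n + 1)).1 x = if x ∈ F n (O n) then n + 1 else (O n).1 x :=
    fun n x => rfl
  have hOle : ∀ n x, (O n).1 x ≤ n := by
    intro n x
    induction n with
    | zero => exact le_rfl
    | succ n ih => rw [hO]; split_ifs <;> omega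
  have hOp : ∀ n x k, (O n).1 x = k + 1 → p k x ≠ 0 := by
    intro n x k
    induction n with
    | zero => intro h0; exact absurd h0 (Nat.succ_ne_zero k).symm
    | succ n ih =>
      rw [hO]
      split_ifs with hx
      · intro hk
        obtain rfl : n = k := by omega
        exact hFp _ _ x hx
      · exact ih
  have hOk : ∀ n k, MeasurableSet {x | (O n).1 x = k} := fun n k =>
    (O n).2 (measurableSet_singleton k)
  -- On the set C of an earlier owner, the S (n+1)-mass exceeds the S n-mass by the integral of p n,
  -- which is exactly the S (n+1)-mass lost to F. The balance is unchanged.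
  have hinv : ∀ n k, k < n → ∀ A : Set Z, MeasurableSet A →
      ∫⁻ x in g ⁻¹' A ∩ {x | (O n).1 x = k + 1}, S n x ∂m = ∫⁻ x in g ⁻¹' A, p k x ∂m := by
    intro n
    induction n with
    | zero => intro k hk; omega
    | succ n ih =>
      intro k hk A hA
      rcases Nat.lt_succ_iff_lt_or_eq.1 hk with hk | rfl
      · set C : Set X := g ⁻¹' A ∩ {x | (O n).1 x = k + 1} with hC
        have hCm : MeasurableSet C := (hg hA).inter (hOk n _)
        have e1 : g ⁻¹' A ∩ {x | (O (n + 1)).1 x = k + 1} = C \ F n (O n) := by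
          ext x
          simp only [hC, mem_inter_iff, mem_preimage, mem_ofPred_eq, Set.mem_sdiff, hO]
          split_ifs with hx
          · simp [hx]; omega
          · simp [hx]
        have e2 := hFA n (O n) (A ×ˢ {k + 1}) (hA.prod (measurableSet_singleton _))
        have e3 : (fun x => (g x, (O n).1 x)) ⁻¹' (A ×ˢ {k + 1}) = C := by
          ext x; simp [hC]
        rw [e3] at e2
        have e4 := lintegral_inter_add_sdiff (μ := m) (S (n + 1)) C (hF n (O n))
        rw [e2] at e4
        have e5 : ∫⁻ x in C, S (n + 1) x ∂m = ∫⁻ x in C, p n x ∂m + ∫⁻ x in C, S n x ∂m := by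
          rw [← lintegral_add_left (hp n)]
          exact lintegral_congr fun x => by rw [hSsucc, add_comm]
        have hfin : ∫⁻ x in C, p n x ∂m ≠ ∞ := by
          refine ne_top_of_le_ne_top (hSfin (n + 1)) ((setLIntegral_le_lintegral _ _).trans ?_)
          exact lintegral_mono fun x => (hSsucc n x).symm ▸ le_add_self
        rw [e5] at e4
        rw [e1, (ENNReal.add_right_inj hfin).1 e4, ih k hk A hA]
      · have e1 : {x | (O (k + 1)).1 x = k + 1} = F k (O k) := by
          ext x
          have := hOle k x
          simp only [mem_ofPred_eq, hO]
          split_ifs with hx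
          · simp [hx]
          · simp [hx]; omega
        have e2 := hFA k (O k) (A ×ˢ univ) (hA.prod MeasurableSet.univ)
        have e3 : (fun x => (g x, (O k).1 x)) ⁻¹' (A ×ˢ univ) = g ⁻¹' A := by
          ext x; simp
        rw [e3] at e2
        rw [e1, e2]
  have hlim : ∀ᵐ x ∂m, Tendsto (fun n => S n x) atTop (𝓝 1) := by
    filter_upwards [hsum] with x hx
    exact hx ▸ ENNReal.tendsto_nat_tsum _
  -- Borel–Cantelli: the claims have finite total S-mass, and S tends to 1, so infinitely many
  -- claims at x would contribute infinitely many terms above 1/2. Ownership thus stabilizes almost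
  -- everywhere.
  have hev : ∀ᵐ x ∂m, ∀ᶠ n in atTop, x ∉ F n (O n) := by
    have hFn : ∀ n, ∫⁻ x in F n (O n), S (n + 1) x ∂m = ∫⁻ x, p n x ∂m := by
      intro n
      simpa using hFA n (O n) univ MeasurableSet.univ
    have hm : ∀ n, Measurable ((F n (O n)).indicator (S (n + 1))) :=
      fun n => (hS _).indicator (hF _ _)
    have htot : ∫⁻ x, ∑' n, (F n (O n)).indicator (S (n + 1)) x ∂m ≠ ∞ := by
      rw [lintegral_tsum fun n => (hm n).aemeasurable]
      simp_rw [lintegral_indicator (hF _ _), hFn]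
      rw [← lintegral_tsum fun n => (hp n).aemeasurable, lintegral_congr_ae hsum, lintegral_one]
      exact measure_ne_top _ _
    filter_upwards [ae_lt_top (Measurable.tsum hm) htot, hlim] with x hx hlx
    have h0 := ENNReal.tendsto_atTop_zero_of_tsum_ne_top hx.ne
    have h1 := h0.eventually (gt_mem_nhds (show (0 : ℝ≥0∞) < 1 / 2 by simp))
    have h2 := ((tendsto_add_atTop_iff_nat 1).2 hlx).eventually
      (lt_mem_nhds (show (1 / 2 : ℝ≥0∞) < 1 from ENNReal.div_lt_of_lt_mul (by norm_num)))
    filter_upwards [h1, h2] with n hn1 hn2 hxF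
    rw [indicator_of_mem hxF] at hn1
    exact absurd hn1 hn2.not_gt
  refine ⟨fun k => {x | ∀ᶠ n in atTop, (O n).1 x = k + 1}, fun k => ?_, ?_, ?_, ?_⟩
  · exact measurableSet_eventually_eq (fun n => (O n).2) _
  · intro k l hkl
    refine disjoint_left.2 fun x hk hl => ?_
    obtain ⟨n, hn1, hn2⟩ := (Filter.Eventually.and hk hl).exists
    omega
  · intro k x hx
    obtain ⟨n, hn⟩ := Filter.Eventually.exists (show ∀ᶠ n in atTop, (O n).1 x = k + 1 from hx)
    exact hOp n x k hn
  · intro k A hA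
    set D : Set X := {x | ∀ᶠ n in atTop, (O n).1 x = k + 1} with hD
    have hDm : MeasurableSet D := measurableSet_eventually_eq (fun n => (O n).2) _
    have hC : ∀ n, MeasurableSet (g ⁻¹' A ∩ {x | (O n).1 x = k + 1}) :=
      fun n => (hg hA).inter (hOk n _)
    have hT : Tendsto (fun n => ∫⁻ x, (g ⁻¹' A ∩ {x | (O n).1 x = k + 1}).indicator (S n) x ∂m)
        atTop (𝓝 (∫⁻ x, (g ⁻¹' A ∩ D).indicator 1 x ∂m)) := by
      refine tendsto_lintegral_of_dominated_convergence (fun _ => 1)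
        (fun n => (hS n).indicator (hC n)) (fun n => ?_) (by simp) ?_
      · filter_upwards [hS1] with x hx
        exact indicator_le' (fun _ _ => hx n) (fun _ _ => zero_le) x
      · filter_upwards [hlim, hev] with x hx hxF
        obtain ⟨N, hN⟩ := eventually_atTop.1 hxF
        have hconst : ∀ n, N ≤ n → (O n).1 x = (O N).1 x := by
          intro n hn
          induction n, hn using Nat.le_induction with
          | base => rfl
          | succ n hn ih => rw [hO, if_neg (hN n hn), ih]
        by_cases hk : (O N).1 x = k + 1
        · have hxD : x ∈ D := eventually_atTop.2 ⟨N, fun n hn => (hconst n hn).trans hk⟩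
          by_cases hxA : g x ∈ A
          · rw [indicator_of_mem (show x ∈ g ⁻¹' A ∩ D from ⟨hxA, hxD⟩)]
            refine hx.congr' ?_
            filter_upwards [eventually_ge_atTop N] with n hn
            rw [indicator_of_mem]
            exact ⟨hxA, (hconst n hn).trans hk⟩
          · simp [indicator, hxA]
        · have hxD : x ∉ D := by
            intro hxD
            obtain ⟨M, hM⟩ := eventually_atTop.1 hxD
            exact hk ((hconst _ (le_max_left N M)).symm.trans (hM _ (le_max_right N M)))
          rw [indicator_of_notMem (fun hx' => hxD hx'.2)]
          refine tendsto_const_nhds.congr' ?_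
          filter_upwards [eventually_ge_atTop N] with n hn
          rw [indicator_of_notMem]
          exact fun hx' => hk ((hconst n hn).symm.trans hx'.2)
    rw [lintegral_indicator_one ((hg hA).inter hDm)] at hT
    refine tendsto_nhds_unique hT (tendsto_const_nhds.congr' ?_)
    filter_upwards [eventually_gt_atTop k] with n hn
    rw [lintegral_indicator (hC n), hinv n k hn A hA]

/-! ### Transport through rectangular cells -/

/-- Transport along a kernel, cell by cell: if a conull set of `m ⊗ₘ κ` is divided into sets `Q k`
inside rectangles `A k ×ˢ B k`, then some map `T` has the same joint law with `g` as `κ`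
and sends a set `D k ⊆ A k` of mass `(m ⊗ₘ κ) (Q k)` into `B k`. -/
theorem AtomlessGiven.exists_map_of_rectangles [StandardBorelSpace Y] [Nonempty Y]
    {ξ : X → ℝ} {g : X → Z} {m : Measure X}
    [IsFiniteMeasure m] (hξ : Measurable ξ) (hg : Measurable g) (h : AtomlessGiven ξ g m)
    (κ : Kernel X Y) [IsMarkovKernel κ] {Q : ℕ → Set (X × Y)} (hQ : ∀ k, MeasurableSet (Q k))
    (hQd : Pairwise (Function.onFun Disjoint Q)) (hQu : ∀ᵐ q ∂(m ⊗ₘ κ), q ∈ ⋃ k, Q k)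
    {A : ℕ → Set X} {B : ℕ → Set Y} (hB : ∀ k, MeasurableSet (B k))
    (hQAB : ∀ k, Q k ⊆ A k ×ˢ B k) :
    ∃ (T : X → Y) (D : ℕ → Set X), Measurable T ∧ (∀ k, MeasurableSet (D k)) ∧
      Pairwise (Function.onFun Disjoint D) ∧ (∀ᵐ x ∂m, x ∈ ⋃ k, D k) ∧ (∀ k, D k ⊆ A k) ∧
      (∀ k, ∀ᵐ x ∂m, x ∈ D k → T x ∈ B k) ∧ (∀ k, m (D k) = (m ⊗ₘ κ) (Q k)) ∧
      m.map (fun x => (g x, T x)) = (m ⊗ₘ κ).map (Prod.map g id) := by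
  have hp : ∀ k, Measurable fun x => κ x (Prod.mk x ⁻¹' Q k) :=
    fun k => Kernel.measurable_kernel_prodMk_left (hQ k)
  have hsum : ∀ᵐ x ∂m, ∑' k, κ x (Prod.mk x ⁻¹' Q k) = 1 := by
    filter_upwards [Measure.ae_ae_of_ae_compProd hQu] with x hx
    rw [← measure_iUnion (fun k l hkl => (hQd hkl).preimage _)
      (fun k => measurable_prodMk_left (hQ k)), ← preimage_iUnion, ← prob_compl_eq_zero_iff]
    · exact hx
    · exact measurable_prodMk_left (MeasurableSet.iUnion hQ)
  obtain ⟨D, hD, hDd, hDp, hDA⟩ := h.exists_disjoint_measure_eq hξ hg hp hsum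
  have hmass : ∀ k, m (D k) = (m ⊗ₘ κ) (Q k) := by
    intro k
    have := hDA k univ MeasurableSet.univ
    rw [preimage_univ, univ_inter, setLIntegral_univ] at this
    rw [this, Measure.compProd_apply (hQ k)]
  have hDu : ∀ᵐ x ∂m, x ∈ ⋃ k, D k := by
    rw [ae_mem_iff_measure_eq (MeasurableSet.iUnion hD).nullMeasurableSet,
      measure_iUnion hDd hD]
    simp_rw [hmass]
    rw [← measure_iUnion hQd hQ, ← Measure.compProd_apply_univ (κ := κ)]
    exact (ae_mem_iff_measure_eq (MeasurableSet.iUnion hQ).nullMeasurableSet).1 hQu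
  have hDA' : ∀ k, D k ⊆ A k := by
    intro k x hx
    obtain ⟨y, hy⟩ := nonempty_of_measure_ne_zero (hDp k x hx)
    exact (hQAB k hy).1
  have hgid : Measurable (Prod.map g (id : Y → Y)) := hg.prodMap measurable_id
  have hT : ∀ k, ∃ T : X → Y, Measurable T ∧ (m.restrict (D k)).map (fun x => (g x, T x)) =
      ((m ⊗ₘ κ).restrict (Q k)).map (Prod.map g id) := by
    intro k
    -- The first marginals agree because D k carries the mass of Q k conditionally on g, not merely
    -- in total.
    refine (h.mono_ac Measure.restrict_le_self.absolutelyContinuous).exists_map_prodMk_eq hξ hg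
      _ ?_
    ext C hC
    rw [Measure.fst_apply hC, Measure.map_apply hgid (measurable_fst hC),
      Measure.map_apply hg hC, Measure.restrict_apply (hg hC), hDA k C hC,
      Measure.restrict_apply (hgid (measurable_fst hC)),
      Measure.compProd_apply ((hgid (measurable_fst hC)).inter (hQ k)),
      ← lintegral_indicator (hg hC)]
    refine lintegral_congr fun x => ?_
    by_cases hx : g x ∈ C
    · simp only [mem_preimage, hx, indicator_of_mem]
      congr 1
      ext y
      simp [hx]
    · simp [indicator, hx, preimage]
  choose T hTm hT using hT
  obtain ⟨T', hT'm, hT'⟩ := exists_measurable_piecewise D hD T hTm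
    (fun k l hkl x hx => absurd hx.2 (disjoint_left.1 (hDd hkl) hx.1))
  have hT'k : ∀ k, (m.restrict (D k)).map (fun x => (g x, T' x)) =
      ((m ⊗ₘ κ).restrict (Q k)).map (Prod.map g id) := by
    intro k
    rw [← hT k]
    refine Measure.map_congr ?_
    filter_upwards [ae_restrict_mem (hD k)] with x hx
    rw [hT' k hx]
  refine ⟨T', D, hT'm, hD, hDd, hDu, hDA', fun k => ?_, hmass, ?_⟩
  · have h1 := congrArg (fun ρ => ρ (univ ×ˢ (B k)ᶜ)) (hT'k k)
    have hBm : MeasurableSet ((univ : Set Z) ×ˢ (B k)ᶜ) := MeasurableSet.univ.prod (hB k).compl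
    rw [Measure.map_apply (hg.prodMk hT'm) hBm, Measure.map_apply hgid hBm,
      Measure.restrict_apply (hgid hBm)] at h1
    have h2 : Prod.map g id ⁻¹' (univ ×ˢ (B k)ᶜ) ∩ Q k = ∅ := by
      ext q
      simp only [mem_inter_iff, mem_preimage, mem_prod, mem_univ, true_and, mem_compl_iff,
        mem_empty_iff_false, iff_false, not_and]
      exact fun hq hqQ => hq (hQAB k hqQ).2
    rw [h2, measure_empty] at h1
    have h3 : ∀ᵐ x ∂(m.restrict (D k)), T' x ∈ B k := by
      rw [ae_iff]
      convert h1 using 2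
      ext x; simp
    exact (ae_restrict_iff' (hD k)).1 h3
  · have e1 : m = Measure.sum fun k => m.restrict (D k) := by
      rw [← Measure.restrict_iUnion hDd hD, Measure.restrict_eq_self_of_ae_mem hDu]
    have e2 : m ⊗ₘ κ = Measure.sum fun k => (m ⊗ₘ κ).restrict (Q k) := by
      rw [← Measure.restrict_iUnion hQd hQ, Measure.restrict_eq_self_of_ae_mem hQu]
    conv_lhs => rw [e1]
    rw [e2, Measure.map_sum (hg.prodMk hT'm).aemeasurable, Measure.map_sum hgid.aemeasurable]
    exact congrArg Measure.sum (funext hT'k)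

/-! ### Control of the marginals and of the cost -/

open scoped NNReal

lemma map_withDensity_comp_eq_bind {g : X → Z} {m : Measure X} [SFinite m]
    (hg : Measurable g) {κ : Kernel X Y} [IsSFiniteKernel κ] {T : X → Y} (hT : Measurable T)
    (h : m.map (fun x => (g x, T x)) = (m ⊗ₘ κ).map (Prod.map g id))
    {f : Z → ℝ≥0∞} (hf : Measurable f) :
    (m.withDensity (f ∘ g)).map T = (m.withDensity (f ∘ g)).bind κ := by
  ext B hB
  have hφ : Measurable fun q : Z × Y => f q.1 * (B.indicator 1 q.2 : ℝ≥0∞) :=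
    (hf.comp measurable_fst).mul ((measurable_one.indicator hB).comp measurable_snd)
  have hfg : Measurable (f ∘ g) := hf.comp hg
  have hgid : Measurable (Prod.map g (id : Y → Y)) := hg.prodMap measurable_id
  have h1 := congrArg (fun ρ => ∫⁻ q, f q.1 * (B.indicator 1 q.2 : ℝ≥0∞) ∂ρ) h
  rw [lintegral_map hφ (hg.prodMk hT), lintegral_map hφ hgid,
    Measure.lintegral_compProd
      (f := fun q => f (Prod.map g id q).1 * (B.indicator 1 (Prod.map g id q).2 : ℝ≥0∞))
      (hφ.comp hgid)] at h1
  rw [Measure.map_apply hT hB, withDensity_apply _ (hT hB),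
    Measure.bind_apply hB κ.aemeasurable,
    lintegral_withDensity_eq_lintegral_mul _ hfg (κ.measurable_coe hB),
    ← lintegral_indicator (hT hB)]
  have h2 : ∫⁻ x, (T ⁻¹' B).indicator (f ∘ g) x ∂m =
      ∫⁻ x, f (g x) * (B.indicator 1 (T x) : ℝ≥0∞) ∂m := by
    refine lintegral_congr fun x => ?_
    by_cases hx : T x ∈ B
    · rw [indicator_of_mem (show x ∈ T ⁻¹' B from hx), indicator_of_mem hx]
      simp
    · rw [indicator_of_notMem (show x ∉ T ⁻¹' B from hx), indicator_of_notMem hx]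
      simp
  rw [h2, h1]
  refine lintegral_congr fun x => ?_
  simp only [Prod.map_fst, Prod.map_snd, id, Pi.mul_apply, Function.comp_apply]
  rw [lintegral_const_mul _ (measurable_one.indicator hB), lintegral_indicator_one hB]

/-- The constant inf of h over Q separates the two integrands, and its integrals over D and Q
coincide. -/
lemma setLIntegral_le_setLIntegral_of_forall_le {m : Measure X} {π : Measure Y}
    {D : Set X} {Q : Set Y} (hD : MeasurableSet D) (hQ : MeasurableSet Q) (hDQ : m D = π Q)
    {f : X → ℝ≥0∞} {h : Y → ℝ≥0∞} (hfh : ∀ᵐ x ∂m, x ∈ D → ∀ q ∈ Q, f x ≤ h q) :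
    ∫⁻ x in D, f x ∂m ≤ ∫⁻ q in Q, h q ∂π := by
  calc ∫⁻ x in D, f x ∂m ≤ ∫⁻ _ in D, (⨅ q ∈ Q, h q) ∂m :=
        lintegral_mono_ae ((ae_restrict_iff' hD).2 (hfh.mono fun x hx hxD => le_iInf₂ (hx hxD)))
    _ = ∫⁻ _ in Q, (⨅ q ∈ Q, h q) ∂π := by rw [setLIntegral_const, setLIntegral_const, hDQ]
    _ ≤ ∫⁻ q in Q, h q ∂π :=
        lintegral_mono_ae ((ae_restrict_iff' hQ).2 (Eventually.of_forall fun q hq =>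
          iInf₂_le q hq))

/-- A continuous cost and a measurable weight vary little on countably many rectangles. -/
lemma exists_rectangles_small_oscillation [TopologicalSpace X] [SecondCountableTopology X]
    [OpensMeasurableSpace X] [TopologicalSpace Y] [SecondCountableTopology Y]
    [OpensMeasurableSpace Y] {c : X × Y → ℝ≥0∞} (hc : Continuous c) {w : X → ℝ≥0∞}
    (hw : Measurable w) {ε t : ℝ≥0∞} (hε : ε ≠ 0) (ht : 1 < t) (ht' : t ≠ ∞) :
    ∃ (A : ℕ → Set X) (B : ℕ → Set Y), (∀ k, MeasurableSet (A k)) ∧ (∀ k, MeasurableSet (B k)) ∧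
      (∀ k, ∀ x ∈ A k, ∀ y ∈ B k, ∀ x' ∈ A k, ∀ y' ∈ B k,
        c (x, y) ≤ c (x', y') + ε ∧ w x ≤ t * w x') ∧
      ∀ x y, c (x, y) ≠ ∞ → w x ≠ 0 → w x ≠ ∞ → ∃ k, x ∈ A k ∧ y ∈ B k := by
  classical
  let bX := TopologicalSpace.countableBasis X
  let bY := TopologicalSpace.countableBasis Y
  have hbX := TopologicalSpace.isBasis_countableBasis X
  have hbY := TopologicalSpace.isBasis_countableBasis Y
  have : Countable bX := (TopologicalSpace.countable_countableBasis X).to_subtype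
  have : Countable bY := (TopologicalSpace.countable_countableBasis Y).to_subtype
  let good : Set X → Set Y → Prop := fun U V =>
    ∀ x ∈ U, ∀ y ∈ V, ∀ x' ∈ U, ∀ y' ∈ V, c (x, y) ≤ c (x', y') + ε
  -- Cells are basic rectangles of small oscillation, cut along geometric levels of w so that w
  -- varies by a factor of at most t. `none` is an empty cell that keeps the index type nonempty for
  -- the enumeration by ℕ.
  let A : Option (bX × bY × ℤ) → Set X := fun i => i.elim ∅ fun i =>
    if good i.1 i.2.1 then i.1 ∩ w ⁻¹' Ico (t ^ i.2.2) (t ^ (i.2.2 + 1)) else ∅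
  let B : Option (bX × bY × ℤ) → Set Y := fun i => i.elim ∅ fun i => i.2.1
  obtain ⟨e, he⟩ := exists_surjective_nat (Option (bX × bY × ℤ))
  have hA : ∀ i, MeasurableSet (A i) := by
    rintro (_ | i)
    · exact MeasurableSet.empty
    · simp only [A, Option.elim]
      split_ifs
      · exact (hbX.isOpen i.1.2).measurableSet.inter (hw measurableSet_Ico)
      · exact MeasurableSet.empty
  have hB : ∀ i, MeasurableSet (B i) := by
    rintro (_ | i)
    · exact MeasurableSet.empty
    · exact (hbY.isOpen i.2.1.2).measurableSet
  have hosc : ∀ i, ∀ x ∈ A i, ∀ y ∈ B i, ∀ x' ∈ A i, ∀ y' ∈ B i,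
      c (x, y) ≤ c (x', y') + ε ∧ w x ≤ t * w x' := by
    rintro (_ | i) x hx y hy x' hx' y' hy'
    · exact absurd hx (notMem_empty x)
    · simp only [A, Option.elim] at hx hx'
      split_ifs at hx hx' with hi
      · refine ⟨hi x hx.1 y hy x' hx'.1 y' hy', hx.2.2.le.trans ?_⟩
        rw [ENNReal.zpow_add (by positivity) ht', zpow_one, mul_comm]
        gcongr
        exact hx'.2.1
      · exact absurd hx (notMem_empty x)
  refine ⟨fun k => A (e k), fun k => B (e k), fun k => hA _, fun k => hB _, fun k => hosc _, ?_⟩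
  intro x y hxy hw0 hwt
  have hε2 : ε / 2 ≠ 0 := by simp [hε]
  have hnhds : {q | c q ≤ c (x, y) + ε / 2 ∧ c (x, y) ≤ c q + ε / 2} ∈ 𝓝 (x, y) := by
    refine inter_mem ?_ ?_
    · exact (hc.tendsto (x, y)).eventually_le_const (ENNReal.lt_add_right hxy hε2)
    · have h1 : Tendsto (fun q => c q + ε / 2) (𝓝 (x, y)) (𝓝 (c (x, y) + ε / 2)) :=
        (hc.tendsto (x, y)).add tendsto_const_nhds
      exact h1.eventually_const_le (ENNReal.lt_add_right hxy hε2)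
  obtain ⟨U', hU', V', hV', hUV'⟩ := mem_nhds_prod_iff.1 hnhds
  obtain ⟨U, hU, hxU, hUU'⟩ := hbX.mem_nhds_iff.1 hU'
  obtain ⟨V, hV, hyV, hVV'⟩ := hbY.mem_nhds_iff.1 hV'
  have hgood : good U V := by
    intro a ha b hb a' ha' b' hb'
    have h1 := (hUV' (mk_mem_prod (hUU' ha) (hVV' hb))).1
    have h2 := (hUV' (mk_mem_prod (hUU' ha') (hVV' hb'))).2
    calc c (a, b) ≤ c (x, y) + ε / 2 := h1
      _ ≤ c (a', b') + ε / 2 + ε / 2 := by gcongr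
      _ = c (a', b') + ε := by rw [add_assoc, ENNReal.add_halves]
  obtain ⟨n, hn⟩ := ENNReal.exists_mem_Ico_zpow hw0 hwt ht ht'
  obtain ⟨k, hk⟩ := he (some (⟨U, hU⟩, ⟨V, hV⟩, n))
  refine ⟨k, ?_, ?_⟩
  · simp only [hk, A, Option.elim, if_pos hgood]
    exact ⟨hxU, hn⟩
  · simp only [hk, B, Option.elim]
    exact hyV

/-- A kernel of finite cost can be replaced by a map with the same joint law with `g`, at an
arbitrarily small increase of the cost. -/
theorem AtomlessGiven.exists_map_lintegral_le [TopologicalSpace X] [SecondCountableTopology X]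
    [OpensMeasurableSpace X] [TopologicalSpace Y] [SecondCountableTopology Y]
    [OpensMeasurableSpace Y] [StandardBorelSpace Y] [Nonempty Y]
    {ξ : X → ℝ} {g : X → Z} {m η : Measure X} [IsFiniteMeasure m] [IsProbabilityMeasure η]
    (hξ : Measurable ξ) (hg : Measurable g) (h : AtomlessGiven ξ g m)
    (hηm : η ≪ m) (hmη : m ≪ η) (κ : Kernel X Y) [IsMarkovKernel κ]
    {c : X × Y → ℝ≥0∞} (hc : Continuous c) (hfin : ∫⁻ q, c q ∂(η ⊗ₘ κ) ≠ ∞)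
    {ε : ℝ≥0∞} (hε : ε ≠ 0) (hε' : ε ≠ ∞) :
    ∃ T : X → Y, Measurable T ∧ m.map (fun x => (g x, T x)) = (m ⊗ₘ κ).map (Prod.map g id) ∧
      ∫⁻ x, c (x, T x) ∂η ≤ (1 + ε) * (∫⁻ q, c q ∂(η ⊗ₘ κ) + ε) := by
  set w : X → ℝ≥0∞ := η.rnDeriv m with hwdef
  have hw : Measurable w := Measure.measurable_rnDeriv _ _
  have hcm : Measurable c := hc.measurable
  have hηw : m.withDensity w = η := Measure.withDensity_rnDeriv_eq _ _ hηm
  have hint : ∀ f : X × Y → ℝ≥0∞, Measurable f →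
      ∫⁻ q, f q ∂(η ⊗ₘ κ) = ∫⁻ q, w q.1 * f q ∂(m ⊗ₘ κ) := by
    intro f hf
    rw [Measure.lintegral_compProd hf,
      Measure.lintegral_compProd (f := fun q => w q.1 * f q) ((hw.comp measurable_fst).mul hf), ← hηw,
      lintegral_withDensity_eq_lintegral_mul _ hw hf.lintegral_kernel_prod_right']
    refine lintegral_congr fun x => ?_
    rw [Pi.mul_apply]
    exact (lintegral_const_mul _ (hf.comp measurable_prodMk_left)).symm
  obtain ⟨A, B, hA, hB, hosc, hcov⟩ := exists_rectangles_small_oscillation hc hw hε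
    (t := 1 + ε) (ENNReal.lt_add_right ENNReal.one_ne_top hε) (by simp [hε'])
  let Q : ℕ → Set (X × Y) := disjointed fun k => A k ×ˢ B k
  have hQ : ∀ k, MeasurableSet (Q k) := fun k =>
    MeasurableSet.disjointed (fun i => (hA i).prod (hB i)) k
  have hQd : Pairwise (Function.onFun Disjoint Q) := disjoint_disjointed _
  have hQAB : ∀ k, Q k ⊆ A k ×ˢ B k := fun k => disjointed_subset _ k
  -- The rectangles miss only points where c is infinite or w is 0 or infinite. Finite cost and m ≪
  -- η make the first case null.
  have hQu : ∀ᵐ q ∂(m ⊗ₘ κ), q ∈ ⋃ k, Q k := by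
    have h1 : ∀ᵐ q ∂(m ⊗ₘ κ), c q < ∞ :=
      (hmη.compProd_left κ).ae_le (ae_lt_top hcm hfin)
    have h2 : ∀ᵐ q ∂(m ⊗ₘ κ), 0 < w q.1 :=
      Measure.ae_compProd_of_ae_fst κ (measurableSet_lt measurable_const hw)
        (hmη.ae_le (Measure.rnDeriv_pos hηm))
    have h3 : ∀ᵐ q ∂(m ⊗ₘ κ), w q.1 < ∞ :=
      Measure.ae_compProd_of_ae_fst κ (measurableSet_lt hw measurable_const)
        (Measure.rnDeriv_lt_top _ _)
    filter_upwards [h1, h2, h3] with q hq1 hq2 hq3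
    rw [iUnion_disjointed]
    obtain ⟨k, hk1, hk2⟩ := hcov q.1 q.2 hq1.ne hq2.ne' hq3.ne
    exact mem_iUnion.2 ⟨k, hk1, hk2⟩
  obtain ⟨T, D, hT, hD, hDd, hDu, hDA, hTB, hmass, hmap⟩ :=
    h.exists_map_of_rectangles hξ hg κ hQ hQd hQu hB hQAB
  refine ⟨T, hT, hmap, ?_⟩
  have hcT : Measurable fun x => c (x, T x) := hcm.comp (measurable_id.prodMk hT)
  have hF : Measurable fun q => (1 + ε) * (c q + ε) := (hcm.add_const ε).const_mul _
  calc ∫⁻ x, c (x, T x) ∂η = ∫⁻ x, w x * c (x, T x) ∂m := by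
        rw [← hηw, lintegral_withDensity_eq_lintegral_mul _ hw hcT]
        rfl
    _ = ∑' k, ∫⁻ x in D k, w x * c (x, T x) ∂m := by
        rw [← lintegral_iUnion hD hDd, Measure.restrict_eq_self_of_ae_mem hDu]
    _ ≤ ∑' k, ∫⁻ q in Q k, w q.1 * ((1 + ε) * (c q + ε)) ∂(m ⊗ₘ κ) := by
        refine ENNReal.tsum_le_tsum fun k =>
          setLIntegral_le_setLIntegral_of_forall_le (hD k) (hQ k) (hmass k) ?_
        filter_upwards [hTB k] with x hxB hxD q hq
        obtain ⟨h1, h2⟩ := hosc k x (hDA k hxD) (T x) (hxB hxD) q.1 (hQAB k hq).1 q.2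
          (hQAB k hq).2
        calc w x * c (x, T x) ≤ ((1 + ε) * w q.1) * (c q + ε) := mul_le_mul' h2 h1
          _ = w q.1 * ((1 + ε) * (c q + ε)) := by ring
    _ = ∫⁻ q, w q.1 * ((1 + ε) * (c q + ε)) ∂(m ⊗ₘ κ) := by
        rw [← lintegral_iUnion hQ hQd, Measure.restrict_eq_self_of_ae_mem hQu]
    _ = (1 + ε) * (∫⁻ q, c q ∂(η ⊗ₘ κ) + ε) := by
        rw [← hint _ hF, lintegral_const_mul _ (hcm.add_const ε), lintegral_add_right _
          measurable_const, lintegral_const, measure_univ, mul_one]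

lemma le_of_forall_le_one_add_mul_add {a C : ℝ≥0∞}
    (h : ∀ ε : ℝ≥0∞, ε ≠ 0 → ε ≠ ∞ → a ≤ (1 + ε) * (C + ε)) : a ≤ C := by
  rcases eq_or_ne C ∞ with rfl | hC
  · exact le_top
  lift C to ℝ≥0 using hC
  have hcont : Continuous fun ε : ℝ≥0 => (((1 + ε) * (C + ε) : ℝ≥0) : ℝ≥0∞) := by fun_prop
  have hlim := (hcont.tendsto 0).mono_left (nhdsWithin_le_nhds (s := Ioi 0))
  simp only [add_zero, one_mul] at hlim
  refine ge_of_tendsto hlim ?_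
  filter_upwards [self_mem_nhdsWithin] with ε hε
  have := h ε (by simpa using (ne_of_gt hε)) ENNReal.coe_ne_top
  push_cast
  exact this

/-! ### The average measure and its densities -/

section Average

variable {d : ℕ} (μ : Fin d → Measure X)

lemma isProbabilityMeasure_avgMeasure [∀ j, IsFiniteMeasure (μ j)]
    (h : ∑ j, μ j univ ≠ 0) : IsProbabilityMeasure (avgMeasure μ) := by
  constructor
  rw [avgMeasure, Measure.smul_apply, Measure.finsetSum_apply, smul_eq_mul]
  exact ENNReal.inv_mul_cancel h (ENNReal.sum_ne_top.2 fun j _ => measure_ne_top _ _)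

lemma absolutelyContinuous_avgMeasure [∀ j, IsFiniteMeasure (μ j)] (j : Fin d) :
    μ j ≪ avgMeasure μ := by
  intro s hs
  rw [avgMeasure, Measure.smul_apply, Measure.finsetSum_apply, smul_eq_mul, mul_eq_zero] at hs
  rcases hs with hs | hs
  · exact absurd (ENNReal.inv_eq_zero.1 hs)
      (ENNReal.sum_ne_top.2 fun j _ => measure_ne_top _ _)
  · exact Finset.sum_eq_zero_iff.1 hs j (Finset.mem_univ j)

lemma measurable_density : Measurable (density μ) :=
  measurable_pi_lambda _ fun _ => (Measure.measurable_rnDeriv _ _).ennreal_toReal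

lemma withDensity_density_eq [∀ j, IsFiniteMeasure (μ j)] [SigmaFinite (avgMeasure μ)]
    (j : Fin d) :
    (avgMeasure μ).withDensity ((fun z : Fin d → ℝ => ENNReal.ofReal (z j)) ∘ density μ) =
      μ j := by
  rw [← Measure.withDensity_rnDeriv_eq _ _ (absolutelyContinuous_avgMeasure μ j)]
  refine withDensity_congr_ae ?_
  filter_upwards [Measure.rnDeriv_lt_top (μ j) (avgMeasure μ)] with x hx
  rw [Function.comp_apply, density, ENNReal.ofReal_toReal hx.ne]

end Average

/-! ### Maps, kernels and plans -/

lemma kernelCost_deterministic {c : X × Y → ℝ≥0∞} (hc : Measurable c) (η : Measure X) [SFinite η]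
    {T : X → Y} (hT : Measurable T) :
    kernelCost c η (Kernel.deterministic T hT) = mapCost c η T := by
  rw [kernelCost, mapCost, Measure.lintegral_compProd hc]
  exact lintegral_congr fun x =>
    Kernel.lintegral_deterministic' hT (hc.comp measurable_prodMk_left)

lemma deterministic_mem_transportKernels {d : ℕ} {μ : Fin d → Measure X} {ν : Fin d → Measure Y}
    {T : X → Y} (hT : T ∈ transportMaps μ ν) :
    Kernel.deterministic T hT.1 ∈ transportKernels μ ν :=
  ⟨inferInstance, fun j => by rw [Measure.deterministic_comp_eq_map]; exact hT.2 j⟩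

lemma iInf_planCost_eq_iInf_kernelCost {d : ℕ} (c : X × Y → ℝ≥0∞) (η : Measure X)
    (μ : Fin d → Measure X) (ν : Fin d → Measure Y) :
    (⨅ π ∈ transportPlans η μ ν, planCost c π) =
      ⨅ κ ∈ transportKernels μ ν, kernelCost c η κ := by
  apply le_antisymm
  · exact le_iInf₂ fun κ hκ => iInf₂_le (η ⊗ₘ κ) ⟨κ, hκ, rfl⟩
  · refine le_iInf₂ fun π hπ => ?_
    obtain ⟨κ, hκ, rfl⟩ := hπ
    exact iInf₂_le κ hκ

end SimultaneousOT

theorem theorem3p2 {X Y : Type*}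
    [TopologicalSpace X] [PolishSpace X] [CompactSpace X] [MeasurableSpace X] [BorelSpace X]
    [TopologicalSpace Y] [PolishSpace Y] [CompactSpace Y] [MeasurableSpace Y] [BorelSpace Y]
    (d : ℕ) (hd : 1 ≤ d)
    (μ : Fin d → Measure X) (hμ : ∀ j, IsFiniteMeasure (μ j))
    (ν : Fin d → Measure Y) (hν : ∀ j, IsFiniteMeasure (ν j))
    (hpos : ∀ j, 0 < ν j Set.univ) (hmass : ∀ j, ν j Set.univ ≤ μ j Set.univ)
    (η : Measure X) (hη : IsProbabilityMeasure η)
    (hημ : η ≪ SimultaneousOT.avgMeasure μ) (hμη : SimultaneousOT.avgMeasure μ ≪ η)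
    (hatom : SimultaneousOT.JointlyAtomless μ)
    (c : X × Y → ℝ≥0∞) (hc : Continuous c) :
    (⨅ κ ∈ SimultaneousOT.transportKernels μ ν, SimultaneousOT.kernelCost c η κ) =
        (⨅ T ∈ SimultaneousOT.transportMaps μ ν, SimultaneousOT.mapCost c η T) ∧
      (⨅ π ∈ SimultaneousOT.transportPlans η μ ν, SimultaneousOT.planCost c π) =
        (⨅ T ∈ SimultaneousOT.transportMaps μ ν, SimultaneousOT.mapCost c η T) := by
  open SimultaneousOT in
  rw [iInf_planCost_eq_iInf_kernelCost, and_self_iff]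
  apply le_antisymm
  · refine le_iInf₂ fun T hT => ?_
    rw [← kernelCost_deterministic hc.measurable η hT.1]
    exact iInf₂_le _ (deterministic_mem_transportKernels hT)
  refine le_iInf₂ fun κ hκ => le_of_forall_le_one_add_mul_add fun ε hε hε' => ?_
  have : IsMarkovKernel κ := hκ.1
  rcases eq_or_ne (kernelCost c η κ) ∞ with hfin | hfin
  · simp [hfin]
  have : Nonempty Y := by
    obtain ⟨y, -⟩ := nonempty_of_measure_ne_zero (hpos ⟨0, hd⟩).ne'
    exact ⟨y⟩
  have : IsProbabilityMeasure (avgMeasure μ) := isProbabilityMeasure_avgMeasure μ fun h0 =>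
    ((hpos ⟨0, hd⟩).trans_le (hmass _)).ne' (Finset.sum_eq_zero_iff.1 h0 _ (Finset.mem_univ _))
  obtain ⟨ξ, hξ, hξ0, hind⟩ := hatom
  obtain ⟨T, hT, hmap, hcost⟩ :=
    (atomlessGiven_of_indepFun hξ (measurable_density μ) hξ0 hind).exists_map_lintegral_le hξ
      (measurable_density μ) hημ hμη κ hc hfin hε hε'
  have hTmem : T ∈ transportMaps μ ν := by
    refine ⟨hT, fun j => ?_⟩
    have h1 := map_withDensity_comp_eq_bind (measurable_density μ) hT hmap
      (f := fun z => ENNReal.ofReal (z j)) (by fun_prop)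
    rw [withDensity_density_eq μ j] at h1
    rw [h1]
    exact hκ.2 j
  exact (iInf₂_le T hTmem).trans hcost
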